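/- Throughout, Banach lattices and Banach spaces are real. A vector $x$ of a Banach lattice is called positive if $x\ge 0$, and vectors $x,y$ are disjoint if $|x|\wedge|y|=0$. For $n\ge 1$, a positive $n$-homogeneous polynomial on a Banach lattice $E$ is a map $P:E\to\mathbb{R}$ of the form $P(x)=A(x,\dots,x)$ with $A:E^n\to\mathbb{R}$ a symmetric $n$-linear form such that $A(x_1,\dots,x_n)\ge 0$ whenever $x_1,\dots,x_n\ge 0$; a regular $n$-homogeneous polynomial is a difference of two positive $n$-homogeneous polynomials. A Banach lattice $E$ has - the positive Schur property if every weakly null sequence of positive vectors of $E$ is norm null; - the positive polynomial Schur property if every sequence $(x_j)_{j=1}^\infty$ of positive vectors of $E$, such that $P(x_j)\to 0$ for every $n\ge 1$ and every regular $n$-homogeneous polynomial $P$ on $E$, is norm null; - the weak Dunford–Pettis property if every weakly compact operator from $E$ into any Banach space maps weakly null sequences of pairwise disjoint vectors of $E$ to norm null sequences. **Theorem.** A Banach lattice has the positive Schur property if and only if it has both the weak Dunford–Pettis property and the positive polynomial Schur property. -/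

import Mathlib

open Filter Topology

universe u

/-- A sequence in a real normed space is weakly null if it converges to `0` in the weak topology. -/
def WeaklyNull {E : Type u} [NormedAddCommGroup E] [NormedSpace ℝ E] (x : ℕ → E) : Prop :=
  Tendsto (fun j => toWeakSpace ℝ E (x j)) atTop (𝓝 0)

/-- A sequence in a normed space is norm null if it converges to `0` in norm. -/
def NormNull {E : Type u} [NormedAddCommGroup E] (x : ℕ → E) : Prop :=
  Tendsto (fun j => ‖x j‖) atTop (𝓝 0)

/-- A bounded operator is weakly compact if it maps the closed unit ball to a relatively compact
set for the weak topology of the target. -/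
def IsWeaklyCompactOperator {E F : Type u} [NormedAddCommGroup E] [NormedSpace ℝ E]
    [NormedAddCommGroup F] [NormedSpace ℝ F] (T : E →L[ℝ] F) : Prop :=
  IsCompact (closure (toWeakSpace ℝ F '' (T '' Metric.closedBall 0 1)))

/-- Pairwise disjointness in the sense of Riesz spaces: `|x i| ∧ |x j| = 0` for `i ≠ j`. -/
def PairwiseLatticeDisjoint {E : Type u} [AddCommGroup E] [Lattice E] (x : ℕ → E) : Prop :=
  ∀ i j, i ≠ j → |x i| ⊓ |x j| = 0

/-- `P` is a positive `n`-homogeneous polynomial: it is the restriction to the diagonal of a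
symmetric `n`-linear form that is nonnegative on positive vectors. -/
def IsPositiveHomogeneousPolynomial {E : Type u} [AddCommGroup E] [Module ℝ E] [Lattice E]
    (n : ℕ) (P : E → ℝ) : Prop :=
  ∃ A : MultilinearMap ℝ (fun _ : Fin n => E) ℝ,
    (∀ (σ : Equiv.Perm (Fin n)) (v : Fin n → E), A (fun i => v (σ i)) = A v) ∧
    (∀ v : Fin n → E, (∀ i, 0 ≤ v i) → 0 ≤ A v) ∧
    ∀ x : E, P x = A (fun _ => x)

/-- A regular `n`-homogeneous polynomial: a difference of two positive ones. -/
def IsRegularHomogeneousPolynomial {E : Type u} [AddCommGroup E] [Module ℝ E] [Lattice E]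
    (n : ℕ) (P : E → ℝ) : Prop :=
  ∃ P₁ P₂ : E → ℝ, IsPositiveHomogeneousPolynomial n P₁ ∧ IsPositiveHomogeneousPolynomial n P₂ ∧
    ∀ x : E, P x = P₁ x - P₂ x

/-- The positive Schur property: positive weakly null sequences are norm null. -/
def PositiveSchurProperty (E : Type u) [NormedAddCommGroup E] [NormedSpace ℝ E] [Lattice E] :
    Prop :=
  ∀ x : ℕ → E, (∀ j, 0 ≤ x j) → WeaklyNull x → NormNull x

/-- The positive polynomial Schur property: a positive sequence on which every regular homogeneous
polynomial (of degree `n ≥ 1`; nonzero constants are excluded) tends to `0` is norm null. -/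
def PositivePolynomialSchurProperty (E : Type u) [NormedAddCommGroup E] [NormedSpace ℝ E]
    [Lattice E] : Prop :=
  ∀ x : ℕ → E, (∀ j, 0 ≤ x j) →
    (∀ n : ℕ, 1 ≤ n → ∀ P : E → ℝ, IsRegularHomogeneousPolynomial n P →
      Tendsto (fun j => P (x j)) atTop (𝓝 0)) →
    NormNull x

/-- The weak Dunford–Pettis property: every weakly compact operator into a Banach space maps
pairwise disjoint weakly null sequences to norm null ones. Targets in the universe of `E` are
enough, since an operator may be replaced by its corestriction to the closure of its range. -/
def WeakDunfordPettisProperty (E : Type u) [NormedAddCommGroup E] [NormedSpace ℝ E] [Lattice E] :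
    Prop :=
  ∀ (F : Type u) [NormedAddCommGroup F] [NormedSpace ℝ F] [CompleteSpace F] (T : E →L[ℝ] F),
    IsWeaklyCompactOperator T →
      ∀ x : ℕ → E, PairwiseLatticeDisjoint x → WeaklyNull x → NormNull (fun j => T (x j))

/-! Forward: the moduli of a disjoint weakly null sequence are again weakly null, so the positive
Schur property makes the sequence itself norm null, and any bounded operator preserves this. Also,
every bounded functional is a difference of positive ones, hence a regular polynomial of degree one,
so polynomial nullity implies weak nullity.

Converse: the positive Schur property need only be tested on disjoint sequences
(`DisjointPositiveSchur.positiveSchurProperty`). On a disjoint weakly null sequence `x`, every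
positive polynomial tends to zero, by induction on the degree. Its form `A` is bounded, the
functionals `f j = A(x j, …, x j, ·)` are weakly null in the dual by induction, and the weak
Dunford–Pettis property gives `f j (x j) → 0`, because `y ↦ (f j y)` is a weakly compact operator
into `c₀`. The polynomial Schur property then concludes.

The reduction to disjoint sequences subtracts summable overlaps along a subsequence. This needs `x i
⊓ x k → 0` in norm for fixed `i`, which is the order bounded case
`DisjointPositiveSchur.normNull_of_le`. -/

set_option linter.unusedSectionVars false

/-! ### Hahn–Banach and weak nullity -/

/-- Hahn–Banach for a functional prescribed along a linear map. -/
theorem exists_linearMap_comp_eq_of_le_sublinear {V E : Type*} [AddCommGroup V] [Module ℝ V]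
    [AddCommGroup E] [Module ℝ E] (L : V →ₗ[ℝ] E) (M : V →ₗ[ℝ] ℝ) (p : E → ℝ)
    (p_hom : ∀ c : ℝ, 0 < c → ∀ x, p (c • x) = c * p x) (p_add : ∀ x y, p (x + y) ≤ p x + p y)
    (h : ∀ a, M a ≤ p (L a)) :
    ∃ g : E →ₗ[ℝ] ℝ, (∀ a, g (L a) = M a) ∧ ∀ x, g x ≤ p x := by
  have p0 : p 0 = 0 := by
    have := p_hom 2 (by norm_num) 0
    rw [smul_zero] at this
    linarith
  have ker : ∀ a, L a = 0 → M a = 0 := fun a ha => by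
    have h1 := h a
    have h2 := h (-a)
    simp only [map_neg, ha, neg_zero, p0] at h1 h2
    linarith
  -- A linear section of `L` carries `M` to the range; `ker` makes the result independent of the
  -- section.
  obtain ⟨s, hs⟩ := L.rangeRestrict.exists_rightInverse_of_surjective L.range_rangeRestrict
  have hs' : ∀ y : LinearMap.range L, L (s y) = y := fun y =>
    congrArg Subtype.val (LinearMap.congr_fun hs y)
  obtain ⟨g, hg, hgp⟩ := exists_extension_of_le_sublinear ⟨LinearMap.range L, M ∘ₗ s⟩ p p_hom p_add
    (fun y => by simpa [hs'] using h (s y))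
  refine ⟨g, fun a => ?_, hgp⟩
  have h1 := hg ⟨L a, LinearMap.mem_range_self L a⟩
  have h2 := ker (s ⟨L a, LinearMap.mem_range_self L a⟩ - a) (by simp [hs'])
  rw [map_sub, sub_eq_zero] at h2
  exact h1.trans h2

theorem weaklyNull_iff {E : Type u} [NormedAddCommGroup E] [NormedSpace ℝ E] {x : ℕ → E} :
    WeaklyNull x ↔ ∀ f : E →L[ℝ] ℝ, Tendsto (fun j => f (x j)) atTop (𝓝 0) := by
  have hinj : Function.Injective (topDualPairing ℝ E).flip := by
    intro a b hab
    refine (SeparatingDual.eq_iff_forall_dual_eq (R := ℝ)).2 fun f => ?_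
    exact LinearMap.congr_fun hab f
  have := WeakBilin.tendsto_iff_forall_eval_tendsto (l := atTop) (topDualPairing ℝ E).flip
    (f := fun j => toWeakSpace ℝ E (x j)) (x := 0) hinj
  refine this.trans (forall_congr' fun f => ?_)
  have : (topDualPairing ℝ E).flip 0 f = 0 := by simp
  change Tendsto _ _ (𝓝 ((topDualPairing ℝ E).flip 0 f)) ↔ _
  rw [this]
  rfl

theorem WeaklyNull.comp {E : Type u} [NormedAddCommGroup E] [NormedSpace ℝ E] {x : ℕ → E}
    (hx : WeaklyNull x) {n : ℕ → ℕ} (hn : Tendsto n atTop atTop) : WeaklyNull (fun k => x (n k)) :=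
  Tendsto.comp (f := n) hx hn

/-! ### Disjointness in lattice-ordered groups -/

section LatticeOrderedGroup

variable {E : Type u} [AddCommGroup E] [Lattice E] [IsOrderedAddMonoid E]

theorem inf_add_le_of_nonneg {x a b : E} (hx : 0 ≤ x) (ha : 0 ≤ a) (hb : 0 ≤ b) :
    x ⊓ (a + b) ≤ x ⊓ a + x ⊓ b := by
  rw [← sub_le_iff_le_add', sub_inf]
  refine sup_le (le_inf ?_ ?_) (le_inf ?_ ?_)
  · exact (sub_nonpos.2 inf_le_left).trans hx
  · exact (sub_nonpos.2 inf_le_left).trans hb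
  · exact (sub_le_self _ ha).trans inf_le_left
  · rw [sub_le_iff_le_add']
    exact inf_le_right

theorem inf_sum_eq_zero {ι : Type*} {x : E} (hx : 0 ≤ x) {f : ι → E} {s : Finset ι}
    (hf : ∀ i ∈ s, 0 ≤ f i) (h : ∀ i ∈ s, x ⊓ f i = 0) : x ⊓ ∑ i ∈ s, f i = 0 := by
  classical
  induction s using Finset.induction_on with
  | empty => simpa using hx
  | insert a s ha ih =>
    simp only [Finset.mem_insert, forall_eq_or_imp] at hf h
    rw [Finset.sum_insert ha]
    have hs : 0 ≤ ∑ i ∈ s, f i := Finset.sum_nonneg hf.2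
    refine le_antisymm ((inf_add_le_of_nonneg hx hf.1 hs).trans ?_)
      (le_inf hx (add_nonneg hf.1 hs))
    rw [h.1, ih hf.2 h.2, add_zero]

theorem inf_eq_zero_of_le {x y a b : E} (hx : 0 ≤ x) (hy : 0 ≤ y) (hxa : x ≤ a) (hyb : y ≤ b)
    (h : a ⊓ b = 0) : x ⊓ y = 0 :=
  le_antisymm ((inf_le_inf hxa hyb).trans h.le) (le_inf hx hy)

/-- Meeting `|a| ≤ |a + b| + |b|` with `|a|` kills the last term, and for disjoint vectors the sum
of the moduli is their supremum. -/
theorem abs_add_abs_le_of_disjoint {a b : E} (h : |a| ⊓ |b| = 0) : |a| + |b| ≤ |a + b| := by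
  have key : ∀ {a b : E}, |a| ⊓ |b| = 0 → |a| ≤ |a + b| := fun {a b} h => by
    have h1 : |a| ≤ |a + b| + |b| := by
      simpa using abs_add_le (a + b) (-b)
    calc |a| = |a| ⊓ (|a + b| + |b|) := (inf_eq_left.2 h1).symm
      _ ≤ |a| ⊓ |a + b| + |a| ⊓ |b| :=
          inf_add_le_of_nonneg (abs_nonneg _) (abs_nonneg _) (abs_nonneg _)
      _ ≤ |a + b| := by rw [h, add_zero]; exact inf_le_right
  rw [← inf_add_sup |a| |b|, h, zero_add]
  exact sup_le (key h) (by rw [add_comm]; exact key (by rwa [inf_comm]))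

theorem abs_sum_le_sum_abs_of_lattice {ι : Type*} (x : ι → E) (s : Finset ι) :
    |∑ i ∈ s, x i| ≤ ∑ i ∈ s, |x i| :=
  Finset.le_sum_of_subadditive _ abs_zero.le abs_add_le s x

theorem sum_abs_le_abs_sum_of_disjoint {ι : Type*} {x : ι → E} {s : Finset ι}
    (h : ∀ i ∈ s, ∀ j ∈ s, i ≠ j → |x i| ⊓ |x j| = 0) : ∑ i ∈ s, |x i| ≤ |∑ i ∈ s, x i| := by
  classical
  induction s using Finset.induction_on with
  | empty => simp
  | insert a s ha ih =>
    rw [Finset.sum_insert ha, Finset.sum_insert ha]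
    have hd : |x a| ⊓ ∑ i ∈ s, |x i| = 0 :=
      inf_sum_eq_zero (abs_nonneg _) (fun _ _ => abs_nonneg _) fun i hi =>
        h a (Finset.mem_insert_self _ _) i (Finset.mem_insert_of_mem hi) fun e => ha (e ▸ hi)
    refine le_trans ?_ (abs_add_abs_le_of_disjoint (inf_eq_zero_of_le (abs_nonneg _) (abs_nonneg _)
      le_rfl (abs_sum_le_sum_abs_of_lattice x s) hd))
    gcongr
    exact ih fun i hi j hj => h i (Finset.mem_insert_of_mem hi) j (Finset.mem_insert_of_mem hj)

end LatticeOrderedGroup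

/-! ### Positive functionals and weakly null sequences -/

section Lattice

variable {E : Type u} [NormedAddCommGroup E] [NormedSpace ℝ E] [Lattice E] [IsOrderedAddMonoid E]
  [HasSolidNorm E]

theorem norm_le_norm_of_nonneg_of_le {x y : E} (hx : 0 ≤ x) (hxy : x ≤ y) : ‖x‖ ≤ ‖y‖ :=
  norm_le_norm_of_abs_le_abs (by rwa [abs_of_nonneg hx, abs_of_nonneg (hx.trans hxy)])

theorem norm_posPart_le (x : E) : ‖x⁺‖ ≤ ‖x‖ := by
  rw [← norm_abs_eq_norm x]
  exact norm_le_norm_of_nonneg_of_le (posPart_nonneg x)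
    (by rw [← posPart_add_negPart]; exact le_add_of_nonneg_right (negPart_nonneg x))

theorem norm_negPart_le (x : E) : ‖x⁻‖ ≤ ‖x‖ := by
  simpa using norm_posPart_le (-x)

theorem posPart_add_le (x y : E) : (x + y)⁺ ≤ x⁺ + y⁺ :=
  sup_le (add_le_add (le_posPart x) (le_posPart y))
    (add_nonneg (posPart_nonneg x) (posPart_nonneg y))

theorem norm_posPart_add_le (x y : E) : ‖(x + y)⁺‖ ≤ ‖x⁺‖ + ‖y⁺‖ :=
  (norm_le_norm_of_nonneg_of_le (posPart_nonneg _) (posPart_add_le x y)).trans (norm_add_le _ _)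

theorem norm_negPart_add_le (x y : E) : ‖(x + y)⁻‖ ≤ ‖x⁻‖ + ‖y⁻‖ := by
  have := norm_posPart_add_le (-x) (-y)
  rwa [← neg_add, posPart_neg, posPart_neg, posPart_neg] at this

variable [IsOrderedModule ℝ E]

theorem smul_posPart_of_pos {c : ℝ} (hc : 0 < c) (x : E) : (c • x)⁺ = c • x⁺ := by
  refine le_antisymm (sup_le (smul_le_smul_of_nonneg_left (le_posPart x) hc.le)
    (smul_nonneg hc.le (posPart_nonneg x))) ?_
  have h : x⁺ ≤ c⁻¹ • (c • x)⁺ := by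
    refine sup_le ?_ (smul_nonneg (inv_pos.2 hc).le (posPart_nonneg _))
    have := smul_le_smul_of_nonneg_left (le_posPart (c • x)) (inv_pos.2 hc).le
    rwa [inv_smul_smul₀ hc.ne'] at this
  have := smul_le_smul_of_nonneg_left h hc.le
  rwa [smul_inv_smul₀ hc.ne'] at this

theorem smul_negPart_of_pos {c : ℝ} (hc : 0 < c) (x : E) : (c • x)⁻ = c • x⁻ := by
  have := smul_posPart_of_pos hc (-x)
  rwa [smul_neg, posPart_neg, posPart_neg] at this

theorem abs_smul_vector (c : ℝ) (x : E) : |c • x| = |c| • |x| := by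
  have pos : ∀ {c : ℝ}, 0 < c → |c • x| = c • |x| := fun hc => by
    rw [← posPart_add_negPart, ← posPart_add_negPart, smul_add, smul_posPart_of_pos hc,
      smul_negPart_of_pos hc]
  rcases lt_trichotomy c 0 with h | rfl | h
  · rw [← abs_neg, ← neg_smul, pos (neg_pos.2 h), abs_of_neg h]
  · simp
  · rw [pos h, abs_of_pos h]

/-- Every bounded functional on a normed lattice is a difference of positive bounded functionals. -/
theorem ContinuousLinearMap.exists_eq_sub_of_nonneg (f : E →L[ℝ] ℝ) :
    ∃ g h : E →L[ℝ] ℝ, (∀ x, 0 ≤ x → 0 ≤ g x) ∧ (∀ x, 0 ≤ x → 0 ≤ h x) ∧ f = g - h := by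
  -- Extend `f` from the diagonal of `E × E`. The majorant vanishes at `(x, 0)` for `x ≤ 0` and at
  -- `(0, x)` for `x ≥ 0`, so `F (·, 0)` and `-F (0, ·)` are positive.
  obtain ⟨F, hF, hFp⟩ := exists_linearMap_comp_eq_of_le_sublinear
    (LinearMap.id.prod LinearMap.id : E →ₗ[ℝ] E × E) f.toLinearMap
    (fun z => ‖f‖ * (‖z.1⁺‖ + ‖z.2⁻‖))
    (fun c hc x => by
      simp only [Prod.smul_fst, Prod.smul_snd, smul_posPart_of_pos hc, smul_negPart_of_pos hc,
        norm_smul, Real.norm_eq_abs, abs_of_pos hc]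
      ring)
    (fun x y => by
      have h1 := norm_posPart_add_le x.1 y.1
      have h2 := norm_negPart_add_le x.2 y.2
      simp only [Prod.fst_add, Prod.snd_add, ← mul_add]
      exact mul_le_mul_of_nonneg_left (by linarith) (norm_nonneg f))
    (fun a => by
      have h1 := (le_abs_self _).trans (f.le_opNorm a)
      have h2 := norm_sub_le a⁺ a⁻
      rw [posPart_sub_negPart] at h2
      exact h1.trans (by gcongr; exact h2))
  have h1 : ∀ x : E, F (x, 0) ≤ ‖f‖ * ‖x⁺‖ := fun x => by simpa using hFp (x, 0)
  have h2 : ∀ x : E, F (0, x) ≤ ‖f‖ * ‖x⁻‖ := fun x => by simpa using hFp (0, x)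
  have h1n : ∀ x : E, -F (x, 0) ≤ ‖f‖ * ‖x⁻‖ := fun x => by
    have := h1 (-x)
    rwa [posPart_neg, show ((-x, 0) : E × E) = -(x, 0) by simp, map_neg] at this
  have h2n : ∀ x : E, -F (0, x) ≤ ‖f‖ * ‖x⁺‖ := fun x => by
    have := h2 (-x)
    rwa [negPart_neg, show ((0, -x) : E × E) = -(0, x) by simp, map_neg] at this
  have bp : ∀ x : E, ‖f‖ * ‖x⁺‖ ≤ ‖f‖ * ‖x‖ := fun x => by gcongr; exact norm_posPart_le x
  have bn : ∀ x : E, ‖f‖ * ‖x⁻‖ ≤ ‖f‖ * ‖x‖ := fun x => by gcongr; exact norm_negPart_le x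
  refine ⟨(F ∘ₗ LinearMap.inl ℝ E E).mkContinuous ‖f‖ fun x => ?_,
    (-(F ∘ₗ LinearMap.inr ℝ E E)).mkContinuous ‖f‖ fun x => ?_, fun x hx => ?_, fun x hx => ?_, ?_⟩
  · exact abs_le'.2 ⟨(h1 x).trans (bp x), (h1n x).trans (bn x)⟩
  · rw [LinearMap.neg_apply, norm_neg]
    exact abs_le'.2 ⟨(h2 x).trans (bn x), (h2n x).trans (bp x)⟩
  · have := h1n x
    rw [negPart_eq_zero.2 hx, norm_zero, mul_zero] at this
    simpa using this
  · have := h2 x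
    rw [negPart_eq_zero.2 hx, norm_zero, mul_zero] at this
    simpa using this
  · ext x
    have := hF x
    rw [show (LinearMap.id.prod LinearMap.id : E →ₗ[ℝ] E × E) x = (x, 0) + (0, x) by simp,
      map_add] at this
    simpa using this.symm

/-- A vector `z ≥ 0` is normed by a positive functional of norm at most one. -/
theorem exists_nonneg_functional_norming {z : E} (hz : 0 ≤ z) :
    ∃ φ : E →L[ℝ] ℝ, (∀ x, 0 ≤ x → 0 ≤ φ x) ∧ (∀ x, φ x ≤ ‖x‖) ∧ φ z = ‖z‖ := by
  -- Domination by `‖x⁺‖` instead of `‖x‖` forces positivity.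
  obtain ⟨F, hF, hFp⟩ := exists_linearMap_comp_eq_of_le_sublinear
    (LinearMap.toSpanSingleton ℝ E z) (LinearMap.toSpanSingleton ℝ ℝ ‖z‖)
    (fun x => ‖x⁺‖)
    (fun c hc x => by
      simp only [smul_posPart_of_pos hc, norm_smul, Real.norm_eq_abs, abs_of_pos hc])
    norm_posPart_add_le
    (fun a => by
      simp only [LinearMap.toSpanSingleton_apply, smul_eq_mul]
      rcases le_or_gt a 0 with ha | ha
      · exact (mul_nonpos_of_nonpos_of_nonneg ha (norm_nonneg _)).trans (norm_nonneg _)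
      · rw [smul_posPart_of_pos ha, norm_smul, Real.norm_eq_abs, abs_of_pos ha,
          posPart_eq_self.2 hz])
  have hn : ∀ x, -F x ≤ ‖x⁻‖ := fun x => by simpa using hFp (-x)
  refine ⟨F.mkContinuous 1 fun x => ?_, fun x hx => ?_, fun x => ?_, ?_⟩
  · rw [one_mul]
    exact abs_le'.2 ⟨(hFp x).trans (norm_posPart_le x), (hn x).trans (norm_negPart_le x)⟩
  · have := hn x
    rw [negPart_eq_zero.2 hx, norm_zero] at this
    simpa using this
  · exact (hFp x).trans (norm_posPart_le x)
  · simpa using hF 1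

theorem weaklyNull_of_nonneg_functionals {x : ℕ → E}
    (h : ∀ f : E →L[ℝ] ℝ, (∀ y, 0 ≤ y → 0 ≤ f y) → Tendsto (fun j => f (x j)) atTop (𝓝 0)) :
    WeaklyNull x :=
  weaklyNull_iff.2 fun f => by
    obtain ⟨g, k, hg, hk, rfl⟩ := f.exists_eq_sub_of_nonneg
    simpa using (h g hg).sub (h k hk)

theorem WeaklyNull.of_nonneg_of_le {x y : ℕ → E} (hx : WeaklyNull x) (hy : ∀ j, 0 ≤ y j)
    (hyx : ∀ j, y j ≤ x j) : WeaklyNull y :=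
  weaklyNull_of_nonneg_functionals fun f hf =>
    squeeze_zero (fun j => hf _ (hy j))
      (fun j => by have := hf _ (sub_nonneg.2 (hyx j)); rw [map_sub] at this; linarith)
      (weaklyNull_iff.1 hx f)

/-- A positive functional `f` turns `w` into a nonnegative series with partial sums at most `f v`.
-/
theorem weaklyNull_of_sum_le {w : ℕ → E} {v : E} (hw : ∀ j, 0 ≤ w j)
    (hs : ∀ n, ∑ j ∈ Finset.range n, w j ≤ v) : WeaklyNull w :=
  weaklyNull_of_nonneg_functionals fun f hf =>
    (summable_of_sum_range_le (c := f v) (fun j => hf _ (hw j)) fun n => by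
      have := hf _ (sub_nonneg.2 (hs n))
      rw [map_sub, map_sum] at this
      linarith).tendsto_atTop_zero

theorem abs_smul_inf_abs_smul_eq_zero {x y : E} (h : |x| ⊓ |y| = 0) (c d : ℝ) :
    |c • x| ⊓ |d • y| = 0 := by
  have key : ∀ {x y : E} (t : ℝ), |x| ⊓ |y| = 0 → |x| ⊓ |t • y| = 0 := fun {x y} t h => by
    obtain ⟨n, hn⟩ := exists_nat_ge |t|
    refine inf_eq_zero_of_le (abs_nonneg _) (abs_nonneg _) le_rfl ?_
      (inf_sum_eq_zero (s := Finset.range n) (f := fun _ => |y|) (abs_nonneg x)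
        (fun _ _ => abs_nonneg _) fun _ _ => h)
    rw [abs_smul_vector, Finset.sum_const, Finset.card_range, ← Nat.cast_smul_eq_nsmul ℝ]
    exact smul_le_smul_of_nonneg_right hn (abs_nonneg y)
  refine key d ?_
  rw [inf_comm] at h ⊢
  exact key c h

/-- The moduli of a disjoint weakly null sequence are weakly null. -/
theorem WeaklyNull.abs_of_disjoint {x : ℕ → E} (hx : WeaklyNull x)
    (hd : PairwiseLatticeDisjoint x) : WeaklyNull fun j => |x j| :=
  weaklyNull_of_nonneg_functionals fun φ hφ => by
    have mono : ∀ {a b : E}, a ≤ b → φ a ≤ φ b := fun h => by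
      have := hφ _ (sub_nonneg.2 h)
      rw [map_sub] at this
      linarith
    -- A functional with `F (x j) = φ |x j|`, dominated by `φ |·|`. Disjointness gives the
    -- domination on the span, through `∑ |a j • x j| ≤ |∑ a j • x j|`.
    obtain ⟨F, hF, hFp⟩ := exists_linearMap_comp_eq_of_le_sublinear
      (Finsupp.linearCombination ℝ x) (Finsupp.linearCombination ℝ fun j => φ |x j|)
      (fun y => φ |y|)
      (fun c hc y => by simp only [abs_smul_vector, abs_of_pos hc, map_smul, smul_eq_mul])
      (fun y z => by rw [← map_add]; exact mono (abs_add_le y z))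
      (fun a => by
        rw [Finsupp.linearCombination_apply, Finsupp.linearCombination_apply, Finsupp.sum,
          Finsupp.sum]
        refine le_trans ?_ (mono (sum_abs_le_abs_sum_of_disjoint fun i _ j _ hij =>
          abs_smul_inf_abs_smul_eq_zero (hd i j hij) _ _))
        rw [map_sum]
        refine Finset.sum_le_sum fun i _ => ?_
        rw [abs_smul_vector, map_smul, smul_eq_mul, smul_eq_mul]
        exact mul_le_mul_of_nonneg_right (le_abs_self _) (hφ _ (abs_nonneg _)))
    have hb : ∀ y, φ |y| ≤ ‖φ‖ * ‖y‖ := fun y => by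
      have := (le_abs_self _).trans (φ.le_opNorm |y|)
      rwa [norm_abs_eq_norm] at this
    have := weaklyNull_iff.1 hx (F.mkContinuous ‖φ‖ fun y =>
      abs_le'.2 ⟨(hFp y).trans (hb y), by simpa using (hFp (-y)).trans (hb (-y))⟩)
    refine this.congr fun j => ?_
    simpa using hF (Finsupp.single j 1)

end Lattice

/-! ### Reduction of the positive Schur property to disjoint sequences -/

theorem exists_frequently_le_norm_of_not_normNull {E : Type u} [NormedAddCommGroup E] {x : ℕ → E}
    (hx : ¬ NormNull x) : ∃ ε : ℝ, 0 < ε ∧ ∃ᶠ k in atTop, ε ≤ ‖x k‖ := by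
  by_contra! h
  refine hx (Metric.tendsto_nhds.2 fun ε hε => ?_)
  filter_upwards [h ε hε] with k hk
  simpa using hk

/-- Extraction of a subsequence along which a matrix with null rows decays geometrically. -/
theorem exists_strictMono_forall_lt_abs_le {P : ℕ → Prop} (hP : ∃ᶠ k in atTop, P k)
    {q : ℕ → ℕ → ℝ} (hq : ∀ i, Tendsto (q i) atTop (𝓝 0)) {η : ℝ} (hη : 0 < η) :
    ∃ n : ℕ → ℕ, StrictMono n ∧ (∀ k, P (n k)) ∧
      ∀ i k, i < k → |q (n i) (n k)| ≤ η * (1 / 2) ^ i * (1 / 2) ^ k := by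
  -- The bound involves positions in the subsequence, so each chosen index carries an exponent,
  -- which strictly increases and hence dominates its position.
  obtain ⟨f, hf, hr⟩ := exists_seq_of_forall_finset_exists (α := ℕ × ℕ) (fun a => P a.1)
    (fun a b => a.1 < b.1 ∧ a.2 < b.2 ∧ |q a.1 b.1| ≤ η * (1 / 2) ^ a.2 * (1 / 2) ^ b.2)
    (fun s _ => by
      have h1 : ∀ᶠ k in atTop, ∀ a ∈ s,
          a.1 < k ∧ |q a.1 k| ≤ η * (1 / 2) ^ a.2 * (1 / 2) ^ (s.sup Prod.snd + 1) := by
        refine (eventually_all_finset s).2 fun a _ => (eventually_gt_atTop a.1).and ?_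
        have := (hq a.1).abs
        rw [abs_zero] at this
        exact this.eventually_le_const (by positivity)
      obtain ⟨k, hk, hk'⟩ := (hP.and_eventually h1).exists
      refine ⟨(k, s.sup Prod.snd + 1), hk, fun a ha => ⟨(hk' a ha).1, ?_, (hk' a ha).2⟩⟩
      exact Nat.lt_succ_of_le (Finset.le_sup (f := Prod.snd) ha))
  have hle : ∀ k, k ≤ (f k).2 := fun k =>
    (strictMono_nat_of_lt_succ (f := fun k => (f k).2) fun k =>
      (hr k (k + 1) k.lt_succ_self).2.1).le_apply (x := k)
  refine ⟨fun k => (f k).1, strictMono_nat_of_lt_succ fun k => (hr k (k + 1) k.lt_succ_self).1,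
    hf, fun i k hik => (hr i k hik).2.2.trans ?_⟩
  have hpow : ∀ k, (1 / 2 : ℝ) ^ (f k).2 ≤ (1 / 2) ^ k := fun k =>
    pow_le_pow_of_le_one (by norm_num) (by norm_num) (hle k)
  exact mul_le_mul (mul_le_mul_of_nonneg_left (hpow i) hη.le) (hpow k) (by positivity)
    (by positivity)

section LatticeOrderedGroup

variable {E : Type u} [AddCommGroup E] [Lattice E] [IsOrderedAddMonoid E]

/-- `y⁺` lies below every `(a i)⁺`, so it is disjoint from `∑ (a i)⁻`; but `∑ a i ≤ 0` also puts it
below that sum. -/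
theorem nonpos_of_le_posPart_of_sum_nonpos {ι : Type*} {s : Finset ι} (hs : s.Nonempty) {a : ι → E}
    (ha : ∑ i ∈ s, a i ≤ 0) {y : E} (hy : ∀ i ∈ s, y ≤ (a i)⁺) : y ≤ 0 := by
  have hy' : ∀ i ∈ s, y⁺ ≤ (a i)⁺ := fun i hi => sup_le (hy i hi) (posPart_nonneg _)
  have h0 : y⁺ ⊓ ∑ i ∈ s, (a i)⁻ = 0 :=
    inf_sum_eq_zero (posPart_nonneg y) (fun i _ => negPart_nonneg _) fun i hi =>
      inf_eq_zero_of_le (posPart_nonneg _) (negPart_nonneg _) (hy' i hi) le_rfl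
        (posPart_inf_negPart_eq_zero (a i))
  obtain ⟨j, hj⟩ := hs
  have h1 : y⁺ ≤ ∑ i ∈ s, (a i)⁻ := by
    refine (hy' j hj).trans ((Finset.single_le_sum (f := fun i => (a i)⁺)
      (fun i _ => posPart_nonneg _) hj).trans ?_)
    rw [← sub_nonpos, ← Finset.sum_sub_distrib]
    simpa using ha
  rw [inf_eq_left.2 h1] at h0
  exact (le_posPart y).trans h0.le

theorem partialSups_le_sum_of_nonneg {f : ℕ → E} (hf : ∀ j, 0 ≤ f j) (m : ℕ) :
    partialSups f m ≤ ∑ j ∈ Finset.range (m + 1), f j :=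
  partialSups_le _ _ _ fun _ hj => Finset.single_le_sum (fun i _ => hf i)
    (Finset.mem_range.2 (Nat.lt_succ_of_le hj))

end LatticeOrderedGroup

section DisjointSequences

variable {E : Type u} [NormedAddCommGroup E] [NormedSpace ℝ E] [CompleteSpace E] [Lattice E]
  [IsOrderedAddMonoid E] [IsOrderedModule ℝ E] [HasSolidNorm E]

/-- Every disjoint weakly null sequence of positive vectors is norm null. -/
def DisjointPositiveSchur (E : Type u) [NormedAddCommGroup E] [NormedSpace ℝ E] [Lattice E] :
    Prop :=
  ∀ y : ℕ → E, (∀ j, 0 ≤ y j) → PairwiseLatticeDisjoint y → WeaklyNull y → NormNull y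

theorem DisjointPositiveSchur.normNull_of_norm_inf_tendsto (hE : DisjointPositiveSchur E)
    {x : ℕ → E} (hx0 : ∀ j, 0 ≤ x j) (hx : WeaklyNull x)
    (hinf : ∀ i, Tendsto (fun k => ‖x i ⊓ x k‖) atTop (𝓝 0)) : NormNull x := by
  by_contra hcon
  obtain ⟨ε, hε, hfreq⟩ := exists_frequently_le_norm_of_not_normNull hcon
  obtain ⟨n, hn, hnε, hnq⟩ := exists_strictMono_forall_lt_abs_le hfreq hinf
    (show 0 < ε / 8 by positivity)
  simp only [abs_norm] at hnq
  let z : ℕ → E := fun k => x (n k)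
  have hz0 : ∀ k, 0 ≤ z k := fun k => hx0 _
  -- The overlaps of `z k` with the other terms. Removing their sum makes the terms disjoint and
  -- costs at most `ε / 4` in norm.
  let c : ℕ → ℕ → E := fun k i => if i = k then 0 else z k ⊓ z i
  have hc0 : ∀ k i, 0 ≤ c k i := fun k i => by
    dsimp only [c]
    split_ifs
    · exact le_rfl
    · exact le_inf (hz0 _) (hz0 _)
  have hcn : ∀ k i, ‖c k i‖ ≤ ε / 8 * (1 / 2) ^ i := fun k i => by
    have hp : ∀ m : ℕ, (1 / 2 : ℝ) ^ m ≤ 1 := fun m => pow_le_one₀ (by norm_num) (by norm_num)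
    dsimp only [c]
    split_ifs with h
    · rw [norm_zero]; positivity
    · rcases lt_or_gt_of_ne h with h | h
      · rw [inf_comm]
        exact (hnq i k h).trans (mul_le_of_le_one_right (by positivity) (hp k))
      · refine (hnq k i h).trans ?_
        rw [mul_right_comm]
        exact mul_le_of_le_one_right (by positivity) (hp k)
  have hgeo : HasSum (fun i : ℕ => ε / 8 * (1 / 2 : ℝ) ^ i) (ε / 4) := by
    have := hasSum_geometric_two.mul_left (ε / 8)
    rwa [show ε / 8 * 2 = ε / 4 by ring] at this
  have hcs : ∀ k, Summable (c k) := fun k => Summable.of_norm_bounded hgeo.summable (hcn k)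
  have hct : ∀ k, ‖∑' i, c k i‖ ≤ ε / 4 := fun k => tsum_of_norm_bounded hgeo (hcn k)
  have hct0 : ∀ k, 0 ≤ ∑' i, c k i := fun k => tsum_nonneg (hc0 k)
  let y : ℕ → E := fun k => (z k - ∑' i, c k i)⁺
  have hy0 : ∀ k, 0 ≤ y k := fun k => posPart_nonneg _
  have hyz : ∀ k, y k ≤ z k := fun k => sup_le (sub_le_self _ (hct0 k)) (hz0 k)
  have hyi : ∀ k i, i ≠ k → y k ≤ z k - z k ⊓ z i := fun k i hik => by
    refine sup_le (sub_le_sub_left ?_ _) (sub_nonneg.2 inf_le_left)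
    have := (hcs k).le_tsum i fun j _ => hc0 k j
    simpa [c, hik] using this
  have hyd : PairwiseLatticeDisjoint y := fun i k hik => by
    rw [abs_of_nonneg (hy0 i), abs_of_nonneg (hy0 k)]
    refine inf_eq_zero_of_le (hy0 i) (hy0 k) (hyi i k hik.symm) (hyi k i hik) ?_
    rw [inf_comm (z k) (z i), ← inf_sub, sub_self]
  have hynull := hE y hy0 hyd ((hx.comp hn.tendsto_atTop).of_nonneg_of_le hy0 hyz)
  obtain ⟨k, hk⟩ := (hynull.eventually_lt_const (show 0 < ε / 2 by positivity)).exists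
  have h1 : ‖z k‖ ≤ ‖y k‖ + ‖∑' i, c k i‖ :=
    (norm_le_norm_of_nonneg_of_le (hz0 k) (sub_le_iff_le_add.1 (le_posPart _))).trans
      (norm_add_le _ _)
  have h2 : ε ≤ ‖z k‖ := hnε k
  have h3 := hct k
  linarith

/-- Induction on the multiplicity: meeting the terms after `x i` with `x i` lowers it by one, so
these meets are norm null. -/
theorem DisjointPositiveSchur.normNull_of_finite_multiplicity (hE : DisjointPositiveSchur E)
    (M : ℕ) : ∀ {x : ℕ → E}, (∀ j, 0 ≤ x j) → WeaklyNull x →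
      (∀ s : Finset ℕ, s.card = M + 1 → ∀ y, (∀ i ∈ s, y ≤ x i) → y ≤ 0) → NormNull x := by
  induction M with
  | zero =>
    intro x hx0 _ hM
    have : ∀ j, x j = 0 := fun j =>
      le_antisymm (hM {j} (by simp) (x j) (by simp)) (hx0 j)
    simp [NormNull, this]
  | succ M ih =>
    intro x hx0 hx hM
    refine hE.normNull_of_norm_inf_tendsto hx0 hx fun i => ?_
    rw [← tendsto_add_atTop_iff_nat (i + 1)]
    have hshift := hx.comp (tendsto_add_atTop_nat (i + 1))
    refine ih (x := fun k => x i ⊓ x (k + (i + 1))) (fun k => le_inf (hx0 _) (hx0 _))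
      (hshift.of_nonneg_of_le (fun k => le_inf (hx0 _) (hx0 _)) fun k => inf_le_right)
      fun s hs y hy => ?_
    have hi : i ∉ s.map (addRightEmbedding (i + 1)) := by
      simp only [Finset.mem_map, addRightEmbedding_apply, not_exists, not_and]
      intro a _ h
      omega
    refine hM (insert i (s.map (addRightEmbedding (i + 1)))) ?_ y fun k hk => ?_
    · rw [Finset.card_insert_of_notMem hi, Finset.card_map, hs]
    · rcases Finset.mem_insert.1 hk with rfl | hk
      · obtain ⟨a, ha⟩ := Finset.card_pos.1 (by omega : 0 < s.card)
        exact (hy a ha).trans inf_le_left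
      · obtain ⟨a, ha, rfl⟩ := Finset.mem_map.1 hk
        exact (hy a ha).trans inf_le_right

/-- The truncations `(w k - δ • v)⁺` have finite multiplicity: `M + 1` of the `w k` sum to at most
`v ≤ (M + 1) • δ • v` once `δ⁻¹ ≤ M`. -/
theorem DisjointPositiveSchur.normNull_of_sum_le (hE : DisjointPositiveSchur E) {w : ℕ → E}
    {v : E} (hw : ∀ j, 0 ≤ w j) (hs : ∀ n, ∑ j ∈ Finset.range n, w j ≤ v) : NormNull w := by
  have hv : 0 ≤ v := by simpa using hs 0
  refine Metric.tendsto_nhds.2 fun ε hε => ?_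
  obtain ⟨δ, hδ, hδv⟩ : ∃ δ : ℝ, 0 < δ ∧ δ * ‖v‖ ≤ ε / 2 := by
    refine ⟨ε / 2 / (‖v‖ + 1), by positivity, ?_⟩
    rw [div_mul_eq_mul_div, div_le_iff₀ (by positivity)]
    gcongr
    linarith
  obtain ⟨M, hM⟩ := exists_nat_ge δ⁻¹
  have hnull : NormNull fun k => (w k - δ • v)⁺ := by
    refine hE.normNull_of_finite_multiplicity M (fun k => posPart_nonneg _)
      ((weaklyNull_of_sum_le hw hs).of_nonneg_of_le (fun k => posPart_nonneg _) fun k =>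
        sup_le (sub_le_self _ (smul_nonneg hδ.le hv)) (hw k)) fun s hcard y hy => ?_
    refine nonpos_of_le_posPart_of_sum_nonpos (Finset.card_pos.1 (by omega)) ?_ hy
    have h1 : ∑ i ∈ s, w i ≤ v := by
      refine (Finset.sum_le_sum_of_subset_of_nonneg (t := Finset.range (s.sup id + 1))
        (fun i hi => ?_) fun i _ _ => hw i).trans (hs _)
      exact Finset.mem_range.2 (Nat.lt_succ_of_le (Finset.le_sup (f := id) hi))
    have h2 : v ≤ ((M + 1 : ℕ) : ℝ) • δ • v := by
      rw [smul_smul]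
      refine le_trans (one_smul ℝ v).ge (smul_le_smul_of_nonneg_right ?_ hv)
      rw [inv_le_iff_one_le_mul₀ hδ] at hM
      push_cast
      linarith
    rw [Finset.sum_sub_distrib, Finset.sum_const, hcard, ← Nat.cast_smul_eq_nsmul ℝ, sub_nonpos]
    exact h1.trans h2
  filter_upwards [hnull.eventually_lt_const (half_pos hε)] with k hk
  have h1 : ‖w k‖ ≤ ‖(w k - δ • v)⁺‖ + ‖δ • v‖ :=
    (norm_le_norm_of_nonneg_of_le (hw k) (sub_le_iff_le_add.1 (le_posPart _))).trans
      (norm_add_le _ _)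
  rw [norm_smul, Real.norm_of_nonneg hδ.le] at h1
  simp only [dist_zero_right, norm_norm]
  linarith

/-- Otherwise there are infinitely many decrements of norm at least `ε`, whose sums telescope below
`s 0`. -/
theorem DisjointPositiveSchur.cauchySeq_of_antitone (hE : DisjointPositiveSchur E) {s : ℕ → E}
    (hs : Antitone s) (hs0 : ∀ k, 0 ≤ s k) : CauchySeq s := by
  by_contra hcon
  rw [Metric.cauchySeq_iff'] at hcon
  push Not at hcon
  obtain ⟨ε, hε, h⟩ := hcon
  choose g hg hgε using h
  have hnull : NormNull fun k => s (g^[k] 0) - s (g^[k + 1] 0) := by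
    refine hE.normNull_of_sum_le (v := s 0) (fun k => ?_) fun n => ?_
    · rw [Function.iterate_succ_apply']
      exact sub_nonneg.2 (hs (hg _))
    · rw [Finset.sum_range_sub']
      exact sub_le_self _ (hs0 _)
  obtain ⟨k, hk⟩ := (hnull.eventually_lt_const hε).exists
  simp only [Function.iterate_succ_apply', ← dist_eq_norm] at hk
  rw [dist_comm] at hk
  exact absurd (hgε (g^[k] 0)) (not_le.2 hk)

theorem DisjointPositiveSchur.cauchySeq_of_monotone (hE : DisjointPositiveSchur E) {s : ℕ → E}
    {v : E} (hs : Monotone s) (hsv : ∀ k, s k ≤ v) : CauchySeq s := by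
  have := hE.cauchySeq_of_antitone (s := fun k => v - s k)
    (fun _ _ h => sub_le_sub_left (hs h) v) fun k => sub_nonneg.2 (hsv k)
  obtain ⟨l, hl⟩ := cauchySeq_tendsto_of_complete this
  exact ((hl.const_sub v).congr fun k => sub_sub_cancel v (s k)).cauchySeq

/-- Let `s k` be the supremum of the tail from `k` of a sparse subsequence. The functional norming
its `k`-th term is small on `s (k + 1)`, so that term has norm at most `‖s k - s (k + 1)‖ + ε / 2`;
but `s` decreases and therefore converges. -/
theorem DisjointPositiveSchur.normNull_of_le (hE : DisjointPositiveSchur E) {z : ℕ → E} {v : E}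
    (hz0 : ∀ j, 0 ≤ z j) (hzv : ∀ j, z j ≤ v) (hz : WeaklyNull z) : NormNull z := by
  by_contra hcon
  obtain ⟨ε, hε, hfreq⟩ := exists_frequently_le_norm_of_not_normNull hcon
  choose φ hφ0 hφn hφ using fun j => exists_nonneg_functional_norming (hz0 j)
  obtain ⟨n, hn, hnε, hnq⟩ := exists_strictMono_forall_lt_abs_le hfreq
    (fun i => weaklyNull_iff.1 hz (φ i)) (show 0 < ε / 4 by positivity)
  have mono : ∀ j {a b : E}, a ≤ b → φ j a ≤ φ j b := fun j {a b} h => by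
    have := hφ0 j _ (sub_nonneg.2 h)
    rw [map_sub] at this
    linarith
  have hlim : ∀ k, ∃ s, Tendsto (partialSups fun j => z (n (k + j))) atTop (𝓝 s) := fun k =>
    cauchySeq_tendsto_of_complete (hE.cauchySeq_of_monotone (partialSups_monotone _)
      fun m => partialSups_le _ m v fun _ _ => hzv _)
  choose s hs using hlim
  have hps : ∀ k m, partialSups (fun j => z (n (k + j))) m ≤ s k := fun k m =>
    (partialSups_monotone _).ge_of_tendsto (hs k) m
  have hzs : ∀ k, z (n k) ≤ s k := fun k =>
    (le_partialSups_of_le (fun j => z (n (k + j))) le_rfl).trans (hps k 0)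
  have hanti : Antitone s := antitone_nat_of_succ_le fun k => by
    refine le_of_tendsto' (hs (k + 1)) fun m => partialSups_le _ _ _ fun j _ => ?_
    rw [add_assoc]
    exact (le_partialSups_of_le (fun j => z (n (k + j))) le_rfl).trans (hps k (1 + j))
  have hsmall : ∀ k, φ (n k) (s (k + 1)) ≤ ε / 2 := fun k => by
    refine le_of_tendsto' (((φ (n k)).continuous.tendsto _).comp (hs (k + 1))) fun m => ?_
    refine (mono _ (partialSups_le_sum_of_nonneg (fun _ => hz0 _) m)).trans ?_
    rw [map_sum]
    have hle : ∀ j, φ (n k) (z (n (k + 1 + j))) ≤ ε / 4 * (1 / 2) ^ j := fun j => by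
      refine (le_abs_self _).trans ((hnq k (k + 1 + j) (by omega)).trans ?_)
      have h1 : (1 / 2 : ℝ) ^ k ≤ 1 := pow_le_one₀ (by norm_num) (by norm_num)
      have h2 : (1 / 2 : ℝ) ^ (k + 1 + j) ≤ (1 / 2) ^ j :=
        pow_le_pow_of_le_one (by norm_num) (by norm_num) (by omega)
      exact mul_le_mul (mul_le_of_le_one_right (by positivity) h1) h2 (by positivity)
        (by positivity)
    refine (Finset.sum_le_sum fun j _ => hle j).trans ?_
    rw [← Finset.mul_sum]
    have := hasSum_geometric_two.summable.sum_le_tsum (Finset.range (m + 1))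
      fun i _ => by positivity
    rw [tsum_geometric_two] at this
    nlinarith
  obtain ⟨l, hl⟩ := cauchySeq_tendsto_of_complete
    (hE.cauchySeq_of_antitone hanti fun k => (hz0 _).trans (hzs k))
  have hdiff : Tendsto (fun k => ‖s k - s (k + 1)‖) atTop (𝓝 0) := by
    simpa using (hl.sub (hl.comp (tendsto_add_atTop_nat 1))).norm
  obtain ⟨k, hk⟩ := (hdiff.eventually_lt_const (half_pos hε)).exists
  have h1 := mono (n k) (hzs k)
  have h2 := hφn (n k) (s k - s (k + 1))
  have h3 : ε ≤ ‖z (n k)‖ := hnε k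
  have h4 := hsmall k
  rw [hφ] at h1
  rw [map_sub] at h2
  linarith

/-- The positive Schur property can be tested on disjoint sequences. -/
theorem DisjointPositiveSchur.positiveSchurProperty (hE : DisjointPositiveSchur E) :
    PositiveSchurProperty E := fun _ hx0 hx =>
  hE.normNull_of_norm_inf_tendsto hx0 hx fun _ =>
    hE.normNull_of_le (fun _ => le_inf (hx0 _) (hx0 _)) (fun _ => inf_le_left)
      (hx.of_nonneg_of_le (fun _ => le_inf (hx0 _) (hx0 _)) fun _ => inf_le_right)

end DisjointSequences

/-! ### Weakly compact operators into `c₀` -/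

/-- If the second adjoint of `T` takes values in the target, then `T` is weakly compact. -/
theorem isWeaklyCompactOperator_of_bidual {E F : Type u} [NormedAddCommGroup E] [NormedSpace ℝ E]
    [NormedAddCommGroup F] [NormedSpace ℝ F] (T : E →L[ℝ] F)
    (h : ∀ G : StrongDual ℝ (StrongDual ℝ E), ∃ z : F, ∀ g : StrongDual ℝ F, G (g ∘L T) = g z) :
    IsWeaklyCompactOperator T := by
  choose S hS using h
  let S' : WeakDual ℝ (StrongDual ℝ E) → WeakSpace ℝ F := fun G =>
    toWeakSpace ℝ F (S (WeakDual.toStrongDual G))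
  have hcont : Continuous S' := by
    refine WeakBilin.continuous_of_continuous_eval (topDualPairing ℝ F).flip fun g => ?_
    exact (WeakDual.eval_continuous (g ∘L T)).congr fun G => hS (WeakDual.toStrongDual G) g
  -- Banach–Alaoglu: the image of the bidual ball is weakly compact and contains the image of the
  -- unit ball of `E`.
  have hK := (WeakDual.isCompact_closedBall (𝕜 := ℝ) (0 : StrongDual ℝ (StrongDual ℝ E)) 1).image
    hcont
  refine hK.closure_of_subset ?_
  rintro _ ⟨_, ⟨x, hx, rfl⟩, rfl⟩
  refine ⟨StrongDual.toWeakDual (NormedSpace.inclusionInDoubleDual ℝ E x), ?_, ?_⟩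
  · have := NormedSpace.double_dual_bound ℝ E x
    rw [mem_closedBall_zero_iff] at hx
    simpa using this.trans hx
  · refine congrArg (toWeakSpace ℝ F) ?_
    refine (SeparatingDual.eq_iff_forall_dual_eq (R := ℝ)).2 fun g => ?_
    exact (hS _ g).symm

section NullSequences

variable {ι : Type u} [TopologicalSpace ι] [DiscreteTopology ι]

open ZeroAtInfty

theorem ZeroAtInftyContinuousMap.norm_le_of_forall {w : C₀(ι, ℝ)} {C : ℝ} (hC : 0 ≤ C)
    (h : ∀ i, |w i| ≤ C) : ‖w‖ ≤ C := by
  rw [← ZeroAtInftyContinuousMap.norm_toBCF_eq_norm]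
  exact (BoundedContinuousFunction.norm_le hC).2 h

theorem ZeroAtInftyContinuousMap.abs_apply_le_norm (w : C₀(ι, ℝ)) (i : ι) : |w i| ≤ ‖w‖ := by
  rw [← ZeroAtInftyContinuousMap.norm_toBCF_eq_norm]
  exact w.toBCF.norm_coe_le_norm i

/-- The null family on a discrete space given by a function that vanishes at infinity. -/
def zeroAtInftyOfTendsto (f : ι → ℝ) (hf : Tendsto f cofinite (𝓝 0)) : C₀(ι, ℝ) :=
  ⟨⟨f, continuous_of_discreteTopology⟩, by simpa [cocompact_eq_cofinite] using hf⟩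

theorem zeroAtInftyOfTendsto_apply (f : ι → ℝ) (hf : Tendsto f cofinite (𝓝 0)) (i : ι) :
    zeroAtInftyOfTendsto f hf i = f i := rfl

variable [DecidableEq ι]

/-- The unit vectors of `C₀(ι, ℝ)` for discrete `ι`. -/
def zeroAtInftySingle (i : ι) : C₀(ι, ℝ) :=
  zeroAtInftyOfTendsto (Pi.single i 1) (tendsto_nhds_of_eventually_eq (by
    filter_upwards [(Set.finite_singleton i).compl_mem_cofinite] with j hj
    exact Pi.single_eq_of_ne hj 1))

theorem ZeroAtInftyContinuousMap.coe_sum_smul_single (s : Finset ι) (a : ι → ℝ) (j : ι) :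
    (∑ i ∈ s, a i • zeroAtInftySingle i : C₀(ι, ℝ)) j = if j ∈ s then a j else 0 := by
  induction s using Finset.induction_on with
  | empty => simp
  | insert i s hi ih =>
    rw [Finset.sum_insert hi, ZeroAtInftyContinuousMap.add_apply, ih,
      ZeroAtInftyContinuousMap.smul_apply, zeroAtInftySingle, zeroAtInftyOfTendsto_apply]
    rcases eq_or_ne j i with rfl | hji
    · simp [hi]
    · simp [hji]

theorem ZeroAtInftyContinuousMap.hasSum_smul_single (w : C₀(ι, ℝ)) :
    HasSum (fun i => w i • zeroAtInftySingle i) w := by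
  rw [HasSum, SummationFilter.unconditional_filter, Metric.tendsto_atTop]
  intro ε hε
  have hw : Tendsto w cofinite (𝓝 0) := by
    simpa [cocompact_eq_cofinite] using w.zero_at_infty'
  have hfin : {i | ¬ |w i| < ε / 2}.Finite := by
    have := hw.eventually (Metric.ball_mem_nhds 0 (half_pos hε))
    simpa using this
  refine ⟨hfin.toFinset, fun s hs => ?_⟩
  rw [dist_eq_norm]
  refine lt_of_le_of_lt (norm_le_of_forall (half_pos hε).le fun j => ?_) (half_lt_self hε)
  rw [ZeroAtInftyContinuousMap.sub_apply, coe_sum_smul_single]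
  split_ifs with hj
  · simpa using (half_pos hε).le
  · rw [zero_sub, abs_neg]
    by_contra hcon
    exact hj (hs (hfin.mem_toFinset.2 fun h => hcon h.le))

/-- Test `g` on finite sums of unit vectors with the signs of its coefficients; these have norm at
most one. -/
theorem summable_abs_apply_single (g : StrongDual ℝ C₀(ι, ℝ)) :
    Summable fun i => |g (zeroAtInftySingle i)| := by
  refine summable_of_sum_le (c := ‖g‖) (fun _ => abs_nonneg _) fun s => ?_
  let w : C₀(ι, ℝ) :=
    ∑ i ∈ s, (SignType.sign (g (zeroAtInftySingle i)) : ℝ) • zeroAtInftySingle i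
  have hw : ‖w‖ ≤ 1 := ZeroAtInftyContinuousMap.norm_le_of_forall zero_le_one fun j => by
    rw [ZeroAtInftyContinuousMap.coe_sum_smul_single]
    split_ifs
    · rcases lt_trichotomy (g (zeroAtInftySingle j)) 0 with h | h | h <;> simp [h]
    · simp
  calc ∑ i ∈ s, |g (zeroAtInftySingle i)| = g w := by
        simp only [w, map_sum, map_smul, smul_eq_mul, sign_mul_self]
    _ ≤ ‖g‖ * ‖w‖ := (le_abs_self _).trans (g.le_opNorm w)
    _ ≤ ‖g‖ := mul_le_of_le_one_right (norm_nonneg g) hw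

variable {E : Type u} [NormedAddCommGroup E] [NormedSpace ℝ E]

/-- The operator into `C₀(ι, ℝ)` given by a bounded pointwise null family of functionals. -/
noncomputable def nullFamilyOperator (f : ι → StrongDual ℝ E) (C : ℝ) (hC : ∀ i, ‖f i‖ ≤ C) (hC0 : 0 ≤ C)
    (hf : ∀ y, Tendsto (fun i => f i y) cofinite (𝓝 0)) : E →L[ℝ] C₀(ι, ℝ) :=
  LinearMap.mkContinuous
    { toFun := fun y => zeroAtInftyOfTendsto (fun i => f i y) (hf y)
      map_add' := fun y z => by ext i; simp [zeroAtInftyOfTendsto_apply]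
      map_smul' := fun c y => by ext i; simp [zeroAtInftyOfTendsto_apply] }
    C fun y => ZeroAtInftyContinuousMap.norm_le_of_forall (by positivity) fun i =>
      ((f i).le_opNorm y).trans (by gcongr; exact hC i)

theorem nullFamilyOperator_apply (f : ι → StrongDual ℝ E) (C : ℝ) (hC : ∀ i, ‖f i‖ ≤ C)
    (hC0 : 0 ≤ C) (hf : ∀ y, Tendsto (fun i => f i y) cofinite (𝓝 0)) (y : E) (i : ι) :
    nullFamilyOperator f C hC hC0 hf y i = f i y := rfl

/-- The second adjoint sends `G` to the family `G (f i)`, null by `hw`, since the adjoint sends `g`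
to the norm convergent series `∑ g (e i) • f i`. -/
theorem isWeaklyCompactOperator_nullFamilyOperator (f : ι → StrongDual ℝ E) (C : ℝ)
    (hC : ∀ i, ‖f i‖ ≤ C) (hC0 : 0 ≤ C) (hf : ∀ y, Tendsto (fun i => f i y) cofinite (𝓝 0))
    (hw : ∀ G : StrongDual ℝ (StrongDual ℝ E), Tendsto (fun i => G (f i)) cofinite (𝓝 0)) :
    IsWeaklyCompactOperator (nullFamilyOperator f C hC hC0 hf) := by
  refine isWeaklyCompactOperator_of_bidual _ fun G => ⟨zeroAtInftyOfTendsto _ (hw G), fun g => ?_⟩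
  have hsum : Summable fun i => g (zeroAtInftySingle i) • f i := by
    refine Summable.of_norm_bounded ((summable_abs_apply_single g).mul_right C) fun i => ?_
    rw [norm_smul, Real.norm_eq_abs]
    gcongr
    exact hC i
  have hg : ∀ w : C₀(ι, ℝ), HasSum (fun i => w i * g (zeroAtInftySingle i)) (g w) := fun w => by
    simpa using w.hasSum_smul_single.mapL g
  have heq : g ∘L nullFamilyOperator f C hC hC0 hf = ∑' i, g (zeroAtInftySingle i) • f i := by
    ext y
    have h1 := hsum.hasSum.mapL (NormedSpace.inclusionInDoubleDual ℝ E y)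
    have h2 := hg (nullFamilyOperator f C hC hC0 hf y)
    refine h2.unique ?_
    simpa [nullFamilyOperator_apply, mul_comm] using h1
  rw [heq]
  refine (hsum.hasSum.mapL G).unique ?_
  simpa [zeroAtInftyOfTendsto_apply, mul_comm] using hg (zeroAtInftyOfTendsto _ (hw G))

end NullSequences

/-! ### Multilinear forms along disjoint weakly null sequences -/

section WeakDunfordPettis

variable {E : Type u} [NormedAddCommGroup E] [NormedSpace ℝ E] [CompleteSpace E] [Lattice E]

theorem WeakDunfordPettisProperty.tendsto_apply (hE : WeakDunfordPettisProperty E) {x : ℕ → E}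
    (hd : PairwiseLatticeDisjoint x) (hx : WeaklyNull x) {f : ℕ → StrongDual ℝ E}
    (hf : WeaklyNull f) : Tendsto (fun j => f j (x j)) atTop (𝓝 0) := by
  classical
  have hdown : Tendsto (ULift.down : ULift.{u} ℕ → ℕ) cofinite atTop := by
    rw [← Nat.cofinite_eq_atTop]
    exact ULift.down_injective.tendsto_cofinite
  have hG := weaklyNull_iff.1 hf
  have hpt : ∀ y, Tendsto (fun j => f j y) atTop (𝓝 0) := fun y =>
    hG (NormedSpace.inclusionInDoubleDual ℝ E y)
  obtain ⟨C, hC⟩ := banach_steinhaus (g := f) fun y => by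
    obtain ⟨C, hC⟩ := (hpt y).norm.bddAbove_range
    exact ⟨C, fun i => hC ⟨i, rfl⟩⟩
  -- Indexing by `ULift ℕ` puts the target `c₀` in the universe of `E`.
  have hnull := hE _ _ (isWeaklyCompactOperator_nullFamilyOperator (ι := ULift.{u} ℕ)
    (fun i => f i.down) C (fun i => hC _) ((norm_nonneg _).trans (hC 0))
    (fun y => (hpt y).comp hdown) fun G => (hG G).comp hdown) x hd hx
  unfold NormNull at hnull
  refine squeeze_zero_norm (fun j => ?_) hnull
  exact ZeroAtInftyContinuousMap.abs_apply_le_norm (nullFamilyOperator (ι := ULift.{u} ℕ)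
    (fun i => f i.down) C (fun i => hC _) ((norm_nonneg _).trans (hC 0))
    (fun y => (hpt y).comp hdown) (x j)) (ULift.up j)

theorem WeakDunfordPettisProperty.tendsto_multilinear (hE : WeakDunfordPettisProperty E)
    {x : ℕ → E} (hd : PairwiseLatticeDisjoint x) (hx : WeaklyNull x) (n : ℕ)
    (A : ContinuousMultilinearMap ℝ (fun _ : Fin (n + 1) => E) ℝ) :
    Tendsto (fun j => A fun _ => x j) atTop (𝓝 0) := by
  induction n with
  | zero =>
    refine (weaklyNull_iff.1 hx (A.toContinuousLinearMap 0 0)).congr fun j => ?_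
    · simp only [ContinuousMultilinearMap.toContinuousLinearMap_apply]
      congr 1
      ext i
      rw [Subsingleton.elim (α := Fin 1) i 0, Function.update_self]
  | succ n ih =>
    -- Each `G` in the bidual, composed with the curried form, is a bounded scalar form of one
    -- degree less.
    have hf : WeaklyNull fun j => A.curryRight fun _ => x j := weaklyNull_iff.2 fun G =>
      ih (G.compContinuousMultilinearMap A.curryRight)
    refine (hE.tendsto_apply hd hx hf).congr fun j => ?_
    rw [ContinuousMultilinearMap.curryRight_apply]
    congr 1
    ext i
    refine Fin.lastCases ?_ (fun i => ?_) i <;> simp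

end WeakDunfordPettis

/-! ### Automatic boundedness of positive multilinear forms -/

section PositiveMultilinear

variable {E : Type u} [NormedAddCommGroup E] [NormedSpace ℝ E] [Lattice E] [IsOrderedAddMonoid E]
  {n : ℕ} {A : MultilinearMap ℝ (fun _ : Fin n => E) ℝ}

theorem MultilinearMap.apply_le_apply_of_nonneg (hA : ∀ v : Fin n → E, (∀ i, 0 ≤ v i) → 0 ≤ A v)
    {a b : Fin n → E} (ha : ∀ i, 0 ≤ a i) (hab : ∀ i, a i ≤ b i) : A a ≤ A b := by
  classical
  have hb : b = a + (b - a) := by abel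
  rw [hb, A.map_add_univ]
  have h : ∀ s : Finset (Fin n), 0 ≤ A (s.piecewise a (b - a)) := fun s => hA _ fun i => by
    by_cases hi : i ∈ s
    · simpa [hi] using ha i
    · simpa [hi] using hab i
  simpa using Finset.single_le_sum (f := fun s : Finset (Fin n) => A (s.piecewise a (b - a)))
    (fun s _ => h s) (Finset.mem_univ Finset.univ)

/-- Splitting each `v i` as `(v i)⁺ - (v i)⁻` expands both sides into the same nonnegative terms, up
to signs on the left. -/
theorem MultilinearMap.abs_apply_le_apply_abs (hA : ∀ v : Fin n → E, (∀ i, 0 ≤ v i) → 0 ≤ A v)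
    (v : Fin n → E) : |A v| ≤ A fun i => |v i| := by
  classical
  have hv : v = (fun i => (v i)⁺) + fun i => -(v i)⁻ := by
    ext i
    simp [← sub_eq_add_neg]
  have hv' : (fun i => |v i|) = (fun i => (v i)⁺) + fun i => (v i)⁻ := by
    ext i
    exact (posPart_add_negPart (v i)).symm
  rw [hv', A.map_add_univ]
  conv_lhs => rw [hv, A.map_add_univ]
  refine (Finset.abs_sum_le_sum_abs _ _).trans (Finset.sum_le_sum fun s _ => ?_)
  have h1 : s.piecewise (fun i => (v i)⁺) (fun i => -(v i)⁻) = fun i =>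
      (if i ∈ s then (1 : ℝ) else -1) • s.piecewise (fun i => (v i)⁺) (fun i => (v i)⁻) i := by
    ext i
    by_cases hi : i ∈ s <;> simp [hi]
  have h2 : 0 ≤ A (s.piecewise (fun i => (v i)⁺) (fun i => (v i)⁻)) := hA _ fun i => by
    by_cases hi : i ∈ s
    · simp [hi]
    · simp [hi]
  rw [h1, A.map_smul_univ, smul_eq_mul, abs_mul, abs_of_nonneg h2, Finset.abs_prod]
  refine mul_le_of_le_one_left h2 (Finset.prod_le_one (fun _ _ => abs_nonneg _) fun i _ => ?_)
  split_ifs <;> simp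

variable [HasSolidNorm E] [IsOrderedModule ℝ E] [CompleteSpace E]

theorem MultilinearMap.exists_bound_of_nonneg
    (hA : ∀ v : Fin n → E, (∀ i, 0 ≤ v i) → 0 ≤ A v) :
    ∃ C : ℝ, ∀ v : Fin n → E, (∀ i, 0 ≤ v i) → (∀ i, ‖v i‖ ≤ 1) → A v ≤ C := by
  by_contra! h
  -- The factor `(2 ^ k) ^ n` offsets the weights `(1 / 2) ^ k` in the `n` slots, so the value of
  -- `A` at the weighted sums exceeds every `k`.
  choose v hv0 hv1 hv using fun k : ℕ => h (k * (2 ^ k) ^ n)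
  have hsum : ∀ i, Summable fun k : ℕ => ((1 / 2 : ℝ) ^ k) • v k i := fun i =>
    Summable.of_norm_bounded summable_geometric_two fun k => by
      rw [norm_smul, norm_pow, Real.norm_of_nonneg (by norm_num)]
      exact mul_le_of_le_one_right (by positivity) (hv1 k i)
  have hterm : ∀ k i, 0 ≤ ((1 / 2 : ℝ) ^ k) • v k i := fun k i =>
    smul_nonneg (by positivity) (hv0 k i)
  obtain ⟨k, hk⟩ := exists_nat_gt (A fun i => ∑' k : ℕ, ((1 / 2 : ℝ) ^ k) • v k i)
  have h1 := A.apply_le_apply_of_nonneg hA (hterm k)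
    (fun i => (hsum i).le_tsum k fun j _ => hterm j i)
  rw [A.map_smul_univ, Finset.prod_const, Finset.card_univ, Fintype.card_fin, smul_eq_mul] at h1
  have h2 : (k : ℝ) ≤ ((1 / 2 : ℝ) ^ k) ^ n * A (v k) := by
    calc (k : ℝ) = ((1 / 2 : ℝ) ^ k) ^ n * (k * (2 ^ k) ^ n) := by
          rw [mul_left_comm, ← mul_pow, ← mul_pow]
          norm_num
      _ ≤ _ := by gcongr; exact (hv k).le
  linarith

/-- Positive multilinear forms on a Banach lattice are bounded. -/
theorem MultilinearMap.exists_norm_le_of_nonneg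
    (hA : ∀ v : Fin n → E, (∀ i, 0 ≤ v i) → 0 ≤ A v) :
    ∃ C : ℝ, ∀ v : Fin n → E, ‖A v‖ ≤ C * ∏ i, ‖v i‖ := by
  obtain ⟨C, hC⟩ := A.exists_bound_of_nonneg hA
  refine ⟨C, fun v => (A.abs_apply_le_apply_abs hA v).trans ?_⟩
  have h : (fun i => |v i|) = fun i => ‖v i‖ • (‖v i‖⁻¹ • |v i|) := by
    ext i
    rcases eq_or_ne (v i) 0 with hi | hi
    · simp [hi]
    · rw [smul_inv_smul₀ (norm_ne_zero_iff.2 hi)]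
  rw [h, A.map_smul_univ, smul_eq_mul, mul_comm]
  refine mul_le_mul_of_nonneg_right (hC _ (fun i => ?_) fun i => ?_)
    (Finset.prod_nonneg fun _ _ => norm_nonneg _)
  · exact smul_nonneg (inv_nonneg.2 (norm_nonneg _)) (abs_nonneg _)
  · rw [norm_smul, norm_inv, norm_norm, norm_abs_eq_norm]
    exact inv_mul_le_one

end PositiveMultilinear

/-! ### The two implications -/

section Main

variable {E : Type u} [NormedAddCommGroup E] [NormedSpace ℝ E] [CompleteSpace E] [Lattice E]
  [IsOrderedAddMonoid E] [IsOrderedModule ℝ E] [HasSolidNorm E]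

theorem PositiveSchurProperty.weakDunfordPettisProperty (hE : PositiveSchurProperty E) :
    WeakDunfordPettisProperty E := by
  intro F _ _ _ T _ x hd hx
  have h := hE _ (fun _ => abs_nonneg _) (hx.abs_of_disjoint hd)
  simp only [NormNull, norm_abs_eq_norm] at h
  refine squeeze_zero (fun _ => norm_nonneg _) (fun j => T.le_opNorm (x j)) ?_
  simpa using h.const_mul ‖T‖

/-- A positive bounded functional is a positive homogeneous polynomial of degree one. -/
theorem ContinuousLinearMap.isPositiveHomogeneousPolynomial_one {f : E →L[ℝ] ℝ}
    (hf : ∀ x, 0 ≤ x → 0 ≤ f x) : IsPositiveHomogeneousPolynomial 1 f :=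
  ⟨MultilinearMap.ofSubsingleton ℝ E ℝ (0 : Fin 1) f.toLinearMap,
    fun σ v => by simp [Subsingleton.elim (σ 0) 0], fun v hv => by simpa using hf _ (hv 0),
    fun x => by simp⟩

theorem PositiveSchurProperty.positivePolynomialSchurProperty (hE : PositiveSchurProperty E) :
    PositivePolynomialSchurProperty E := fun x hx0 hP =>
  hE x hx0 (weaklyNull_iff.2 fun f => by
    obtain ⟨g, h, hg, hh, rfl⟩ := f.exists_eq_sub_of_nonneg
    exact hP 1 le_rfl _ ⟨g, h, g.isPositiveHomogeneousPolynomial_one hg,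
      h.isPositiveHomogeneousPolynomial_one hh, fun _ => rfl⟩)

theorem WeakDunfordPettisProperty.tendsto_positiveHomogeneousPolynomial
    (hE : WeakDunfordPettisProperty E) {x : ℕ → E} (hd : PairwiseLatticeDisjoint x)
    (hx : WeaklyNull x) {n : ℕ} (hn : 1 ≤ n) {P : E → ℝ}
    (hP : IsPositiveHomogeneousPolynomial n P) : Tendsto (fun j => P (x j)) atTop (𝓝 0) := by
  obtain ⟨m, rfl⟩ := Nat.exists_eq_add_of_le' hn
  obtain ⟨A, -, hA, hPA⟩ := hP
  obtain ⟨C, hC⟩ := A.exists_norm_le_of_nonneg hA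
  exact (hE.tendsto_multilinear hd hx m (A.mkContinuous C hC)).congr fun j => (hPA _).symm

theorem WeakDunfordPettisProperty.positiveSchurProperty (hE : WeakDunfordPettisProperty E)
    (hE' : PositivePolynomialSchurProperty E) : PositiveSchurProperty E :=
  DisjointPositiveSchur.positiveSchurProperty fun x hx0 hd hx => hE' x hx0 fun n hn P hP => by
    obtain ⟨P₁, P₂, h₁, h₂, h⟩ := hP
    simpa [h] using (hE.tendsto_positiveHomogeneousPolynomial hd hx hn h₁).sub
      (hE.tendsto_positiveHomogeneousPolynomial hd hx hn h₂)

end Main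

theorem mainTheorem2 (E : Type u) [NormedAddCommGroup E] [NormedSpace ℝ E] [CompleteSpace E]
    [Lattice E] [IsOrderedAddMonoid E] [IsOrderedModule ℝ E] [HasSolidNorm E] :
    PositiveSchurProperty E ↔
      WeakDunfordPettisProperty E ∧ PositivePolynomialSchurProperty E :=
  ⟨fun h => ⟨h.weakDunfordPettisProperty, h.positivePolynomialSchurProperty⟩,
    fun h => h.1.positiveSchurProperty h.2⟩
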